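/- Let $\Omega$ be a signature that contains a functional symbol (of arity $\ge 1$) and a constant symbol, and let $\mathcal C$ be the class of all (nonempty) models of $\Omega$. For $\mathfrak A,\mathfrak B\in\mathcal C$ write $\mathfrak A\sqsupseteq\mathfrak B$ if $\mathfrak A$ contains (up to isomorphism) $\mathfrak B$ as a submodel. A *(model-theoretic) language* $K$ based on $\Omega$ is a set of sentences with a satisfaction relation between models of $\Omega$ and sentences such that satisfaction is preserved under isomorphisms of models, $K$ is closed under the Boolean connectives, and $K$ includes the first-order language $L_{\omega,\omega}$ over $\Omega$. Write $L\subseteq K$ if, up to renaming of sentences, every sentence of $L$ is a sentence of $K$ with the same models. The *modal sentences* of $K$ are built from sentences of $K$ by Boolean connectives and $\Diamond$, where $\mathfrak A\vDash\Diamond\varphi$ iff $\mathfrak B\vDash\varphi$ for some $\mathfrak B\in\mathcal C$ with $\mathfrak A\sqsupseteq\mathfrak B$. The *modal theory* $\mathrm{MTh}^K(\mathcal C,\sqsupseteq)$ is the set of propositional modal formulas $\alpha(\mathsf p_1,\dots,\mathsf p_n)$ such that $\alpha(\psi_1,\dots,\psi_n)$ holds in every model in $\mathcal C$ for all modal sentences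 $\psi_1,\dots,\psi_n$ of $K$. The theory $\mathrm{MTh}^L(\mathcal C,\sqsupseteq)$ is *robust* if $\mathrm{MTh}^K(\mathcal C,\sqsupseteq)=\mathrm{MTh}^L(\mathcal C,\sqsupseteq)$ for every language $K\supseteq L$. A *normal modal logic* is a set of unimodal propositional formulas that contains all classical tautologies, $\neg\Diamond\bot$ and $\Diamond(\mathsf p\vee\mathsf q)\to\Diamond\mathsf p\vee\Diamond\mathsf q$, and is closed under Modus Ponens, substitution, and the rule $\alpha\to\beta\,/\,\Diamond\alpha\to\Diamond\beta$. $\mathrm{S4}$ is the smallest normal modal logic containing $\Diamond\Diamond\mathsf p\to\Diamond\mathsf p$ and $\mathsf p\to\Diamond\mathsf p$, and $\mathrm{S4.2.1}$ is the smallest normal modal logic that includes $\mathrm{S4}$ and contains $\Box\Diamond\mathsf p\leftrightarrow\Diamond\Box\mathsf p$. **Theorem.** The robust theory of $(\mathcal C,\sqsupseteq)$ is $\mathrm{S4.2.1}$. That is, there is a language $L$ based on $\Omega$ such that $\mathrm{MTh}^L(\mathcal C,\sqsupseteq)$ is robust and equal to $\mathrm{S4.2.1}$, and whenever $\mathrm{MTh}^L(\mathcal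 C,\sqsupseteq)$ is robust, it equals $\mathrm{S4.2.1}$. -/

import Mathlib

universe u v w t

namespace RobustModal

open scoped FirstOrder

/-! ### Propositional modal logic -/

/-- Unimodal formulas over the propositional variables `p₀, p₁, …`,
with `⊥`, `→`, `◇` as the basic connectives. -/
inductive MF : Type
  | var : ℕ → MF
  | bot : MF
  | imp : MF → MF → MF
  | dia : MF → MF

namespace MF

def neg (φ : MF) : MF := imp φ bot
def or (φ ψ : MF) : MF := imp (neg φ) ψ
def and (φ ψ : MF) : MF := neg (imp φ (neg ψ))
def iff (φ ψ : MF) : MF := and (imp φ ψ) (imp ψ φ)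
def box (φ : MF) : MF := neg (dia (neg φ))

/-- Uniform substitution of modal formulas for propositional variables. -/
def subst (σ : ℕ → MF) : MF → MF
  | var n => σ n
  | bot => bot
  | imp φ ψ => imp (subst σ φ) (subst σ ψ)
  | dia φ => dia (subst σ φ)

/-- `φ` is a classical tautology (variables and formulas `◇ψ` being treated as atoms): it is true
under every truth assignment to the formulas that respects `⊥` and `→`. -/
def IsTautology (φ : MF) : Prop :=
  ∀ e : MF → Prop, ¬ e bot → (∀ α β : MF, e (imp α β) ↔ (e α → e β)) → e φ

end MF

/-- Normal propositional unimodal logics. -/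
structure IsNormalLogic (Λ : Set MF) : Prop where
  tautology : ∀ φ : MF, φ.IsTautology → φ ∈ Λ
  dia_bot : MF.neg (MF.dia MF.bot) ∈ Λ
  dia_or : MF.imp (MF.dia (MF.or (MF.var 0) (MF.var 1)))
    (MF.or (MF.dia (MF.var 0)) (MF.dia (MF.var 1))) ∈ Λ
  modus_ponens : ∀ φ ψ : MF, φ ∈ Λ → MF.imp φ ψ ∈ Λ → ψ ∈ Λ
  substitution : ∀ (φ : MF) (σ : ℕ → MF), φ ∈ Λ → MF.subst σ φ ∈ Λ
  monotonicity : ∀ φ ψ : MF, MF.imp φ ψ ∈ Λ → MF.imp (MF.dia φ) (MF.dia ψ) ∈ Λ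

/-- The smallest normal modal logic that includes `Γ`. -/
def leastLogic (Γ : Set MF) : Set MF := ⋂₀ {Λ : Set MF | IsNormalLogic Λ ∧ Γ ⊆ Λ}

/-- `S4` is the smallest normal logic containing `◇◇p → ◇p` and `p → ◇p`. -/
def S4 : Set MF :=
  leastLogic
    {MF.imp (MF.dia (MF.dia (MF.var 0))) (MF.dia (MF.var 0)),
     MF.imp (MF.var 0) (MF.dia (MF.var 0))}

/-- `S4.2.1` is `S4 + (□◇p ↔ ◇□p)`. -/
def S421 : Set MF :=
  leastLogic
    (S4 ∪ {MF.iff (MF.box (MF.dia (MF.var 0))) (MF.dia (MF.box (MF.var 0)))})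

/-! ### Models and model-theoretic languages -/

/-- The (nonempty) models of the signature `Ω`. -/
abbrev Model (Ω : FirstOrder.Language.{u, v}) : Type (max u v (w + 1)) :=
  FirstOrder.Language.Theory.ModelType.{u, v, w} (∅ : Ω.Theory)

/-- A model-theoretic language based on the signature `Ω`: a set of sentences together with a
satisfaction relation between models of `Ω` and sentences, such that satisfaction is preserved
under isomorphisms, the sentences are closed under the classical connectives, and all sentences of
the first-order language `L_{ω,ω}` over `Ω` are included, with their usual meaning.
(The connective `⊥` is supplied by first-order logic.) -/
structure ModelLanguage (Ω : FirstOrder.Language.{u, v}) where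
  Sentence : Type t
  Sat : Model.{u, v, w} Ω → Sentence → Prop
  sat_iso : ∀ A B : Model.{u, v, w} Ω, Nonempty (A ≃[Ω] B) → ∀ φ : Sentence, Sat A φ ↔ Sat B φ
  imp : Sentence → Sentence → Sentence
  sat_imp : ∀ (A : Model.{u, v, w} Ω) (φ ψ : Sentence), Sat A (imp φ ψ) ↔ (Sat A φ → Sat A ψ)
  ofFirstOrder : Ω.Sentence → Sentence
  ofFirstOrder_injective : Function.Injective ofFirstOrder
  sat_ofFirstOrder : ∀ (A : Model.{u, v, w} Ω) (φ : Ω.Sentence),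
    Sat A (ofFirstOrder φ) ↔ FirstOrder.Language.Sentence.Realize A φ

/-- `L ⊆ K`: the sentences of `L` are, up to naming, sentences of `K` with the same meaning. -/
def ModelLanguage.IncludedIn {Ω : FirstOrder.Language.{u, v}}
    (L K : ModelLanguage.{u, v, w, t} Ω) : Prop :=
  ∃ i : L.Sentence → K.Sentence, Function.Injective i ∧
    ∀ (A : Model.{u, v, w} Ω) (φ : L.Sentence), K.Sat A (i φ) ↔ L.Sat A φ

/-- The modal sentences of a language `K`: expressions built from sentences of `K` by means of
the Boolean connectives and `◇`. -/
inductive ModalSentence {Ω : FirstOrder.Language.{u, v}} (K : ModelLanguage.{u, v, w, t} Ω) :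
    Type t
  | of : K.Sentence → ModalSentence K
  | bot : ModalSentence K
  | imp : ModalSentence K → ModalSentence K → ModalSentence K
  | dia : ModalSentence K → ModalSentence K

/-- Satisfaction of modal sentences in models, relative to a class `C` of models and a relation
`R` between models: `◇φ` holds in `A` iff `φ` holds in some `B ∈ C` with `A R B`. -/
def ModalSentence.Sat {Ω : FirstOrder.Language.{u, v}} {K : ModelLanguage.{u, v, w, t} Ω}
    (C : Set (Model.{u, v, w} Ω)) (R : Model.{u, v, w} Ω → Model.{u, v, w} Ω → Prop) :
    Model.{u, v, w} Ω → ModalSentence K → Prop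
  | A, .of ψ => K.Sat A ψ
  | _, .bot => False
  | A, .imp φ ψ => ModalSentence.Sat C R A φ → ModalSentence.Sat C R A ψ
  | A, .dia φ => ∃ B ∈ C, R A B ∧ ModalSentence.Sat C R B φ

/-- The extension of a valuation of the propositional variables by modal sentences of `K` to all
modal formulas. -/
def MF.translate {Ω : FirstOrder.Language.{u, v}} {K : ModelLanguage.{u, v, w, t} Ω}
    (val : ℕ → ModalSentence K) : MF → ModalSentence K
  | .var n => val n
  | .bot => .bot
  | .imp φ ψ => .imp (MF.translate val φ) (MF.translate val ψ)
  | .dia φ => .dia (MF.translate val φ)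

/-- The modal theory of `(C, R)` in the language `K`: the modal formulas that hold in all models
from `C` under all valuations by modal sentences of `K`, that is, the formulas valid in the modal
Lindenbaum algebra of `K` on `(C, R)`. -/
def modalTheory {Ω : FirstOrder.Language.{u, v}} (K : ModelLanguage.{u, v, w, t} Ω)
    (C : Set (Model.{u, v, w} Ω)) (R : Model.{u, v, w} Ω → Model.{u, v, w} Ω → Prop) : Set MF :=
  {φ | ∀ val : ℕ → ModalSentence K, ∀ A ∈ C, ModalSentence.Sat C R A (MF.translate val φ)}

/-- The modal theory of `(C, R)` in `L` is robust: it does not change when `L` is strengthened. -/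
def IsRobust {Ω : FirstOrder.Language.{u, v}} (L : ModelLanguage.{u, v, w, t} Ω)
    (C : Set (Model.{u, v, w} Ω)) (R : Model.{u, v, w} Ω → Model.{u, v, w} Ω → Prop) : Prop :=
  ∀ K : ModelLanguage.{u, v, w, t} Ω, L.IncludedIn K → modalTheory K C R = modalTheory L C R

/-- `Λ` is a robust theory of `(C, R)`: the modal theory of `(C, R)` in some language, and this
theory is robust. The languages range over those whose sentences form a set. -/
def IsRobustTheory {Ω : FirstOrder.Language.{u, v}}
    (C : Set (Model.{u, v, w} Ω)) (R : Model.{u, v, w} Ω → Model.{u, v, w} Ω → Prop)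
    (Λ : Set MF) : Prop :=
  ∃ L : ModelLanguage.{u, v, w, max u v w} Ω, IsRobust L C R ∧ modalTheory L C R = Λ

/-- `A ⊒ B`: the model `A` contains (an isomorphic copy of) `B` as a submodel. -/
def ContainsSubmodel {Ω : FirstOrder.Language.{u, v}} (A B : Model.{u, v, w} Ω) : Prop :=
  ∃ S : Ω.Substructure A, Nonempty (B ≃[Ω] S)

end RobustModal

namespace RobustModal

open scoped FirstOrder

/-! ### Normal logics and their maximal theories -/

/-! Soundness holds for every language. The submodel generated by the constants lies in every
submodel of `A` and has no proper submodel. It is thus a final point below `A`, unique up to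
isomorphism, and `□◇ψ` and `◇□ψ` both say that `ψ` holds there (`S421_subset_modalTheory`).

For completeness, a formula outside `S421` is refuted on a power set ordered by inclusion
(`exists_powerset_countermodel`): the canonical model is unravelled along a tree of lists, a bounded
set of nodes is read at its supremum, and an unbounded one at the final point. Power sets occur as
orders of submodels: in a disjoint union of cycles of distinct lengths and a fixed point, a submodel
is a choice of cycles, and the lengths make this choice invariant under isomorphism
(`RotationModel.containsSubmodel_iff_exists_equiv`).

The refuting valuations are isomorphism-invariant predicates of models, so any language can be
expanded by all of them at once, which brings its modal theory down to `S421`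
(`exists_includedIn_modalTheory_eq`). Since expansion can only shrink the modal theory
(`modalTheory_anti`), being robust amounts to being equal to `S421`. -/

theorem isNormalLogic_leastLogic (Γ : Set MF) : IsNormalLogic (leastLogic Γ) where
  tautology φ h := fun _ hΛ => hΛ.1.tautology φ h
  dia_bot := fun _ hΛ => hΛ.1.dia_bot
  dia_or := fun _ hΛ => hΛ.1.dia_or
  modus_ponens φ ψ h₁ h₂ := fun Λ hΛ => hΛ.1.modus_ponens φ ψ (h₁ Λ hΛ) (h₂ Λ hΛ)
  substitution φ σ h := fun Λ hΛ => hΛ.1.substitution φ σ (h Λ hΛ)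
  monotonicity φ ψ h := fun Λ hΛ => hΛ.1.monotonicity φ ψ (h Λ hΛ)

theorem subset_leastLogic (Γ : Set MF) : Γ ⊆ leastLogic Γ :=
  fun _ hφ _ hΛ => hΛ.2 hφ

theorem leastLogic_subset {Γ Λ : Set MF} (hΛ : IsNormalLogic Λ) (h : Γ ⊆ Λ) :
    leastLogic Γ ⊆ Λ :=
  fun _ hφ => hφ Λ ⟨hΛ, h⟩

theorem isNormalLogic_S421 : IsNormalLogic S421 := isNormalLogic_leastLogic _

theorem S4_subset_S421 : S4 ⊆ S421 :=
  Set.subset_union_left.trans (subset_leastLogic _)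

theorem dia_dia_imp_mem_S421 (φ : MF) : MF.imp (MF.dia (MF.dia φ)) (MF.dia φ) ∈ S421 :=
  isNormalLogic_S421.substitution _ (fun _ => φ)
    (S4_subset_S421 (subset_leastLogic _ (Or.inl rfl)))

theorem imp_dia_mem_S421 (φ : MF) : MF.imp φ (MF.dia φ) ∈ S421 :=
  isNormalLogic_S421.substitution _ (fun _ => φ)
    (S4_subset_S421 (subset_leastLogic _ (Or.inr rfl)))

theorem box_dia_iff_dia_box_mem_S421 (φ : MF) :
    MF.iff (MF.box (MF.dia φ)) (MF.dia (MF.box φ)) ∈ S421 :=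
  isNormalLogic_S421.substitution _ (fun _ => φ) (subset_leastLogic _ (Or.inr rfl))

/-- A theory over `Λ`: a set of formulas that includes `Λ` and is closed under Modus Ponens. -/
structure IsTheory (Λ T : Set MF) : Prop where
  subset : Λ ⊆ T
  mp : ∀ φ ψ, φ ∈ T → MF.imp φ ψ ∈ T → ψ ∈ T

/-- A maximal theory over `Λ`: a set of formulas that includes `Λ` and respects `⊥` and `→`. -/
structure IsMaxTheory (Λ Γ : Set MF) : Prop where
  subset : Λ ⊆ Γ
  bot : MF.bot ∉ Γ
  imp : ∀ φ ψ, MF.imp φ ψ ∈ Γ ↔ (φ ∈ Γ → ψ ∈ Γ)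

/-- Lindenbaum's lemma: by Zorn, take `M` maximal among the theories that omit `χ`. -/
theorem IsTheory.exists_isMaxTheory {Λ T : Set MF} (hΛ : IsNormalLogic Λ) (hT : IsTheory Λ T)
    {χ : MF} (hχ : χ ∉ T) : ∃ Γ, IsMaxTheory Λ Γ ∧ T ⊆ Γ ∧ χ ∉ Γ := by
  obtain ⟨M, hTM, hM⟩ := zorn_subset_nonempty {S | IsTheory Λ S ∧ χ ∉ S} (by
    intro c hc hchain ⟨S₀, hS₀⟩
    refine ⟨⋃₀ c, ⟨⟨fun φ hφ => ⟨S₀, hS₀, (hc hS₀).1.subset hφ⟩, ?_⟩, ?_⟩,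
      fun S hS => Set.subset_sUnion_of_mem hS⟩
    · rintro φ ψ ⟨S₁, h₁, hφ⟩ ⟨S₂, h₂, hψ⟩
      rcases hchain.total h₁ h₂ with h | h
      · exact ⟨S₂, h₂, (hc h₂).1.mp _ _ (h hφ) hψ⟩
      · exact ⟨S₁, h₁, (hc h₁).1.mp _ _ hφ (h hψ)⟩
    · rintro ⟨S, hS, h⟩
      exact (hc hS).2 h) T ⟨hT, hχ⟩
  obtain ⟨⟨hMT, hχM⟩, hmax⟩ := hM
  have taut (φ : MF) (h : φ.IsTautology) : φ ∈ M := hMT.subset (hΛ.tautology φ h)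
  have key (α : MF) (hα : α ∉ M) : MF.imp α χ ∈ M := by
    by_contra hn
    -- This is the theory generated by `M` and `α`; if it omitted `χ`, maximality would put `α` in
    -- `M`.
    have hS : IsTheory Λ {β | MF.imp α β ∈ M} := by
      refine ⟨fun β hβ => ?_, fun β γ hβ hγ => ?_⟩
      · refine hMT.mp _ _ (hMT.subset hβ) (taut _ fun e hb he => ?_)
        simp only [he]; tauto
      · refine hMT.mp _ _ hγ (hMT.mp _ _ hβ (taut _ fun e hb he => ?_))
        simp only [he]; tauto
    have hle : M ⊆ {β | MF.imp α β ∈ M} := fun β hβ =>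
      hMT.mp _ _ hβ (taut _ fun e hb he => by simp only [he]; tauto)
    exact hα (hmax ⟨hS, hn⟩ hle (taut _ fun e hb he => by simp only [he]; tauto))
  refine ⟨M, ⟨hMT.subset, fun h => hχM ?_, fun φ ψ => ⟨fun h hφ => hMT.mp _ _ hφ h, fun h => ?_⟩⟩,
    hTM, hχM⟩
  · exact hMT.mp _ _ h (taut _ fun e hb he => by simp only [he]; tauto)
  · by_cases hφ : φ ∈ M
    · exact hMT.mp _ _ (h hφ) (taut _ fun e hb he => by simp only [he]; tauto)
    · by_contra hn
      -- Both `φ` and `φ → ψ` would imply `χ`, but one of them is always true, so `χ` would follow.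
      refine hχM (hMT.mp _ _ (key _ hn) (hMT.mp _ _ (key _ hφ) (taut _ fun e hb he => ?_)))
      simp only [he]; tauto

namespace IsMaxTheory

variable {Λ Γ Δ : Set MF}

theorem neg (h : IsMaxTheory Λ Γ) (φ : MF) : MF.neg φ ∈ Γ ↔ φ ∉ Γ := by
  simp [MF.neg, h.imp, h.bot]

theorem dia_mono (h : IsMaxTheory Λ Γ) (hΛ : IsNormalLogic Λ) {φ ψ : MF} (hi : MF.imp φ ψ ∈ Λ)
    (hφ : MF.dia φ ∈ Γ) : MF.dia ψ ∈ Γ :=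
  (h.imp _ _).1 (h.subset (hΛ.monotonicity _ _ hi)) hφ

theorem not_dia_bot (h : IsMaxTheory Λ Γ) (hΛ : IsNormalLogic Λ) : MF.dia MF.bot ∉ Γ :=
  (h.neg _).1 (h.subset hΛ.dia_bot)

theorem dia_or (h : IsMaxTheory Λ Γ) (hΛ : IsNormalLogic Λ) {φ ψ : MF}
    (hd : MF.dia (MF.or φ ψ) ∈ Γ) : MF.dia φ ∈ Γ ∨ MF.dia ψ ∈ Γ := by
  have := h.subset (hΛ.substitution _ (fun n => if n = 0 then φ else ψ) hΛ.dia_or)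
  simp only [MF.subst, MF.or, MF.neg, h.imp, h.bot, if_true, one_ne_zero, if_false] at this
  have := this hd
  tauto

end IsMaxTheory

/-- The accessibility relation between maximal theories. -/
def Sees (Γ Δ : Set MF) : Prop := ∀ φ ∈ Δ, MF.dia φ ∈ Γ

/-- The formulas `α` with `□α ∈ Γ` form a theory that omits `¬ψ`; any maximal extension omitting
`¬ψ` is the required point. -/
theorem IsMaxTheory.exists_sees {Λ Γ : Set MF} (h : IsMaxTheory Λ Γ) (hΛ : IsNormalLogic Λ)
    {ψ : MF} (hψ : MF.dia ψ ∈ Γ) : ∃ Δ, IsMaxTheory Λ Δ ∧ Sees Γ Δ ∧ ψ ∈ Δ := by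
  have hT : IsTheory Λ {α | MF.dia (MF.neg α) ∉ Γ} := by
    refine ⟨fun α hα hd => ?_, fun α β hα hαβ hd => ?_⟩
    · refine h.not_dia_bot hΛ (h.dia_mono hΛ ?_ hd)
      refine hΛ.modus_ponens _ _ hα (hΛ.tautology _ fun e hb he => ?_)
      simp only [MF.neg, he]; tauto
    · refine (h.dia_or hΛ (h.dia_mono hΛ (hΛ.tautology _ fun e hb he => ?_) hd)).elim hα hαβ
      simp only [MF.or, MF.neg, he]; tauto
  have hχ : MF.neg ψ ∉ {α | MF.dia (MF.neg α) ∉ Γ} := by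
    refine not_not.2 (h.dia_mono hΛ (hΛ.tautology _ fun e hb he => ?_) hψ)
    simp only [MF.neg, he]; tauto
  obtain ⟨Δ, hΔ, hsub, hn⟩ := hT.exists_isMaxTheory hΛ hχ
  refine ⟨Δ, hΔ, fun α hα => ?_, ?_⟩
  · by_contra hd
    have : MF.neg α ∈ Δ := hsub fun hd' => hd (h.dia_mono hΛ (hΛ.tautology _ fun e hb he => by
      simp only [MF.neg, he]; tauto) hd')
    exact (hΔ.neg _).1 this hα
  · simpa [hΔ.neg] using hn

/-! ### The canonical model of `S4.2.1` -/

namespace S421Model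

variable {Γ Δ Θ : Set MF}

theorem sees_refl (h : IsMaxTheory S421 Γ) : Sees Γ Γ :=
  fun φ hφ => (h.imp _ _).1 (h.subset (imp_dia_mem_S421 φ)) hφ

theorem sees_trans (h : IsMaxTheory S421 Γ) (h₁ : Sees Γ Δ) (h₂ : Sees Δ Θ) : Sees Γ Θ :=
  fun φ hφ => (h.imp _ _).1 (h.subset (dia_dia_imp_mem_S421 φ)) (h₁ _ (h₂ _ hφ))

theorem dia_mem_iff (h : IsMaxTheory S421 Γ) (φ : MF) :
    MF.dia φ ∈ Γ ↔ ∃ Δ, IsMaxTheory S421 Δ ∧ Sees Γ Δ ∧ φ ∈ Δ :=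
  ⟨h.exists_sees isNormalLogic_S421, fun ⟨_, _, hs, hφ⟩ => hs φ hφ⟩

theorem box_mem_iff (h : IsMaxTheory S421 Γ) (φ : MF) :
    MF.box φ ∈ Γ ↔ ∀ Δ, IsMaxTheory S421 Δ → Sees Γ Δ → φ ∈ Δ := by
  rw [MF.box, h.neg, dia_mem_iff h]
  push Not
  refine forall_congr' fun Δ => forall_congr' fun hΔ => forall_congr' fun _ => ?_
  simp [hΔ.neg]

/-- The formulas that hold at the final point seen from `Γ`. -/
def final (Γ : Set MF) : Set MF := {φ | MF.box (MF.dia φ) ∈ Γ}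

theorem mem_final_iff_forall (h : IsMaxTheory S421 Γ) (φ : MF) :
    φ ∈ final Γ ↔ ∀ Δ, IsMaxTheory S421 Δ → Sees Γ Δ → MF.dia φ ∈ Δ :=
  box_mem_iff h _

/-- This is where the axiom `□◇p ↔ ◇□p` enters. It gives `final` an existential description besides
the universal one. -/
theorem mem_final_iff_exists (h : IsMaxTheory S421 Γ) (φ : MF) :
    φ ∈ final Γ ↔ ∃ Δ, IsMaxTheory S421 Δ ∧ Sees Γ Δ ∧
      ∀ Δ', IsMaxTheory S421 Δ' → Sees Δ Δ' → φ ∈ Δ' := by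
  have hax := h.subset (box_dia_iff_dia_box_mem_S421 φ)
  have : MF.box (MF.dia φ) ∈ Γ ↔ MF.dia (MF.box φ) ∈ Γ := by
    simp only [MF.iff, MF.and, h.neg, h.imp] at hax
    tauto
  rw [final, Set.mem_ofPred_eq, this, dia_mem_iff h]
  exact exists_congr fun Δ => and_congr_right fun hΔ => by rw [box_mem_iff hΔ]

theorem dia_mem_of_mem_final (h : IsMaxTheory S421 Γ) {φ : MF} (hφ : φ ∈ final Γ) :
    MF.dia φ ∈ Γ :=
  (mem_final_iff_forall h φ).1 hφ Γ h (sees_refl h)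

/-- The universal description is inherited by successors, the existential one by predecessors. -/
theorem final_eq (h : IsMaxTheory S421 Γ) (hΔ : IsMaxTheory S421 Δ) (hs : Sees Γ Δ) :
    final Γ = final Δ := by
  ext φ
  refine ⟨fun hφ => ?_, fun hφ => ?_⟩
  · rw [mem_final_iff_forall h] at hφ
    rw [mem_final_iff_forall hΔ]
    exact fun Δ' h' hs' => hφ Δ' h' (sees_trans h hs hs')
  · rw [mem_final_iff_exists hΔ] at hφ
    rw [mem_final_iff_exists h]
    obtain ⟨Δ', h', hs', hall⟩ := hφ
    exact ⟨Δ', h', sees_trans h hs hs', hall⟩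

theorem bot_notMem_final (h : IsMaxTheory S421 Γ) : MF.bot ∉ final Γ :=
  fun hb => h.not_dia_bot isNormalLogic_S421 (dia_mem_of_mem_final h hb)

theorem imp_mem_final_iff (h : IsMaxTheory S421 Γ) (φ ψ : MF) :
    MF.imp φ ψ ∈ final Γ ↔ (φ ∈ final Γ → ψ ∈ final Γ) := by
  refine ⟨fun hi hφ => ?_, fun hi => ?_⟩
  -- Move to a point beyond which the implication always holds, then, as `final` has not changed, to
  -- one beyond which `φ` always holds.
  · obtain ⟨Δ, hΔ, hs, hall⟩ := (mem_final_iff_exists h _).1 hi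
    rw [final_eq h hΔ hs] at hφ ⊢
    obtain ⟨Δ', hΔ', hs', hall'⟩ := (mem_final_iff_exists hΔ _).1 hφ
    exact (mem_final_iff_exists hΔ _).2 ⟨Δ', hΔ', hs', fun Ξ hΞ hsΞ =>
      (hΞ.imp _ _).1 (hall Ξ hΞ (sees_trans hΔ hs' hsΞ)) (hall' Ξ hΞ hsΞ)⟩
  · rw [mem_final_iff_exists h]
    by_cases hφ : φ ∈ final Γ
    · obtain ⟨Δ, hΔ, hs, hall⟩ := (mem_final_iff_exists h _).1 (hi hφ)
      exact ⟨Δ, hΔ, hs, fun Ξ hΞ hsΞ => (hΞ.imp _ _).2 fun _ => hall Ξ hΞ hsΞ⟩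
    · rw [mem_final_iff_forall h] at hφ
      push Not at hφ
      obtain ⟨Δ, hΔ, hs, hn⟩ := hφ
      exact ⟨Δ, hΔ, hs, fun Ξ hΞ hsΞ => (hΞ.imp _ _).2 fun hφΞ => absurd (hsΞ _ hφΞ) hn⟩

theorem dia_mem_final_iff (h : IsMaxTheory S421 Γ) (φ : MF) :
    MF.dia φ ∈ final Γ ↔ φ ∈ final Γ := by
  rw [mem_final_iff_forall h, mem_final_iff_forall h]
  refine forall_congr' fun Δ => forall_congr' fun hΔ => forall_congr' fun _ => ⟨?_, ?_⟩
  · exact (hΔ.imp _ _).1 (hΔ.subset (dia_dia_imp_mem_S421 φ))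
  · exact (hΔ.imp _ _).1 (hΔ.subset (imp_dia_mem_S421 _))

open Classical in
/-- The step of the unravelling: a witness for `◇ψ` at `Γ` if there is one, and `Γ` otherwise. -/
noncomputable def witness (Γ : Set MF) (ψ : MF) : Set MF :=
  if h : ∃ Δ, IsMaxTheory S421 Δ ∧ Sees Γ Δ ∧ ψ ∈ Δ then h.choose else Γ

theorem isMaxTheory_witness (h : IsMaxTheory S421 Γ) (ψ : MF) :
    IsMaxTheory S421 (witness Γ ψ) := by
  unfold witness
  split_ifs with hex
  exacts [hex.choose_spec.1, h]

theorem sees_witness (h : IsMaxTheory S421 Γ) (ψ : MF) : Sees Γ (witness Γ ψ) := by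
  unfold witness
  split_ifs with hex
  exacts [hex.choose_spec.2.1, sees_refl h]

theorem mem_witness (h : IsMaxTheory S421 Γ) {ψ : MF} (hψ : MF.dia ψ ∈ Γ) : ψ ∈ witness Γ ψ := by
  have hex := (dia_mem_iff h ψ).1 hψ
  rw [witness, dif_pos hex]
  exact hex.choose_spec.2.2

/-- The unravelling of the canonical model from `Γ`, along the tree of lists of formulas. -/
noncomputable def label (Γ : Set MF) : List MF → Set MF
  | [] => Γ
  | ψ :: t => witness (label Γ t) ψ

theorem isMaxTheory_label (h : IsMaxTheory S421 Γ) : ∀ t, IsMaxTheory S421 (label Γ t)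
  | [] => h
  | ψ :: t => isMaxTheory_witness (isMaxTheory_label h t) ψ

theorem sees_label (h : IsMaxTheory S421 Γ) {s t : List MF} (hst : s <:+ t) :
    Sees (label Γ s) (label Γ t) := by
  induction t with
  | nil => rw [List.suffix_nil.1 hst]; exact sees_refl h
  | cons ψ t ih =>
    rcases List.suffix_cons_iff.1 hst with rfl | hs
    · exact sees_refl (isMaxTheory_label h _)
    · exact sees_trans (isMaxTheory_label h s) (ih hs) (sees_witness (isMaxTheory_label h t) ψ)

/-- `t` is the least upper bound of the set `X` of nodes of the tree of lists. -/
def IsSup (X : Set (List MF)) (t : List MF) : Prop :=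
  (∀ s ∈ X, s <:+ t) ∧ ∀ t', (∀ s ∈ X, s <:+ t') → t <:+ t'

theorem IsSup.unique {X : Set (List MF)} {s t : List MF} (hs : IsSup X s) (ht : IsSup X t) :
    s = t :=
  (hs.2 t ht.1).eq_of_length_le (ht.2 s hs.1).length_le

/-- Shorten the bound until its top lies in `X`, or until it is the root, which serves when `X` is
empty. -/
theorem exists_isSup {X : Set (List MF)} {t : List MF} (h : ∀ s ∈ X, s <:+ t) :
    ∃ t', IsSup X t' := by
  induction t with
  | nil => exact ⟨[], h, fun t' _ => List.nil_suffix⟩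
  | cons ψ t ih =>
    by_cases hX : ψ :: t ∈ X
    · exact ⟨ψ :: t, h, fun t' ht' => ht' _ hX⟩
    · refine ih fun s hs => ((List.suffix_cons_iff.1 (h s hs)).resolve_left ?_)
      rintro rfl
      exact hX hs

theorem isSup_suffixes (t : List MF) : IsSup {s | s <:+ t} t :=
  ⟨fun _ hs => hs, fun _ ht' => ht' t List.suffix_rfl⟩

open Classical in
/-- The set of formulas true at a set `X` of nodes: those that are true at its least upper bound,
or at the final point if `X` is unbounded. -/
noncomputable def truthAt (Γ : Set MF) (X : Set (List MF)) : Set MF :=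
  if h : ∃ t, IsSup X t then label Γ h.choose else final Γ

theorem truthAt_of_isSup {X : Set (List MF)} {t : List MF} (h : IsSup X t) :
    truthAt Γ X = label Γ t := by
  have hex : ∃ t, IsSup X t := ⟨t, h⟩
  rw [truthAt, dif_pos hex, hex.choose_spec.unique h]

theorem truthAt_of_not_isSup {X : Set (List MF)} (h : ¬ ∃ t, IsSup X t) :
    truthAt Γ X = final Γ := dif_neg h

/-- At a bounded set, the node `φ :: t` provides the witness for `◇φ`; conversely, a larger set is
read either at an extension of `t` or at the final point, which `label Γ t` sees in the sense of
`dia_mem_of_mem_final`. Supersets of an unbounded set are unbounded, and at the final point `◇` is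
trivial. -/
theorem dia_mem_truthAt_iff (h : IsMaxTheory S421 Γ) (X : Set (List MF)) (φ : MF) :
    MF.dia φ ∈ truthAt Γ X ↔ ∃ Y, X ⊆ Y ∧ φ ∈ truthAt Γ Y := by
  by_cases hX : ∃ t, IsSup X t
  · obtain ⟨t, ht⟩ := hX
    have hlt := isMaxTheory_label h t
    rw [truthAt_of_isSup ht]
    refine ⟨fun hφ => ⟨{s | s <:+ φ :: t}, fun s hs =>
      (ht.1 s hs).trans (List.suffix_cons φ t), ?_⟩, ?_⟩
    · rw [truthAt_of_isSup (isSup_suffixes _)]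
      exact mem_witness hlt hφ
    · rintro ⟨Y, hXY, hφ⟩
      by_cases hY : ∃ t, IsSup Y t
      · obtain ⟨t', ht'⟩ := hY
        rw [truthAt_of_isSup ht'] at hφ
        exact sees_label h (ht.2 t' fun s hs => ht'.1 s (hXY hs)) φ hφ
      · rw [truthAt_of_not_isSup hY, final_eq h hlt (sees_label h List.nil_suffix)] at hφ
        exact dia_mem_of_mem_final hlt hφ
  · have hall (Y) (hXY : X ⊆ Y) : truthAt Γ Y = final Γ := truthAt_of_not_isSup
      fun ⟨t, ht⟩ => hX (exists_isSup fun s hs => ht.1 s (hXY hs))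
    rw [hall X subset_rfl, dia_mem_final_iff h]
    exact ⟨fun hφ => ⟨X, subset_rfl, by rwa [hall X subset_rfl]⟩,
      fun ⟨Y, hXY, hφ⟩ => by rwa [hall Y hXY] at hφ⟩

end S421Model

open S421Model in
/-- `S4.2.1` is complete with respect to the frame of sets of lists of formulas, ordered by
inclusion. -/
theorem exists_powerset_countermodel {φ : MF} (hφ : φ ∉ S421) :
    ∃ V : Set (List MF) → Set MF, (∀ X, MF.bot ∉ V X) ∧
      (∀ X α β, MF.imp α β ∈ V X ↔ (α ∈ V X → β ∈ V X)) ∧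
      (∀ X α, MF.dia α ∈ V X ↔ ∃ Y, X ⊆ Y ∧ α ∈ V Y) ∧ ∃ X, φ ∉ V X := by
  obtain ⟨Γ, hΓ, -, hn⟩ := IsTheory.exists_isMaxTheory isNormalLogic_S421
    ⟨subset_rfl, isNormalLogic_S421.modus_ponens⟩ hφ
  refine ⟨truthAt Γ, fun X => ?_, fun X α β => ?_, dia_mem_truthAt_iff hΓ,
    {s | s <:+ []}, by rwa [truthAt_of_isSup (isSup_suffixes [])]⟩
  · by_cases hX : ∃ t, IsSup X t
    · obtain ⟨t, ht⟩ := hX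
      rw [truthAt_of_isSup ht]
      exact (isMaxTheory_label hΓ t).bot
    · rw [truthAt_of_not_isSup hX]
      exact bot_notMem_final hΓ
  · by_cases hX : ∃ t, IsSup X t
    · obtain ⟨t, ht⟩ := hX
      rw [truthAt_of_isSup ht]
      exact (isMaxTheory_label hΓ t).imp α β
    · rw [truthAt_of_not_isSup hX]
      exact imp_mem_final_iff hΓ α β

namespace MF

/-- A numbering of the modal formulas. -/
def code : MF → ℕ
  | var n => Nat.pair 0 n
  | bot => Nat.pair 1 0
  | imp φ ψ => Nat.pair 2 (Nat.pair (code φ) (code ψ))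
  | dia φ => Nat.pair 3 (code φ)

theorem code_injective : Function.Injective code := by
  intro φ
  induction φ with
  | var n => intro ψ h; cases ψ <;> simp_all [code, Nat.pair_eq_pair]
  | bot => intro ψ h; cases ψ <;> simp_all [code, Nat.pair_eq_pair]
  | imp α β ihα ihβ =>
    intro ψ h
    cases ψ <;> simp [code, Nat.pair_eq_pair] at h
    rw [ihα h.1, ihβ h.2]
  | dia α ih =>
    intro ψ h
    cases ψ <;> simp [code, Nat.pair_eq_pair] at h
    rw [ih h]

instance : Countable MF := code_injective.countable

end MF

open FirstOrder FirstOrder.Language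

variable {Ω : FirstOrder.Language.{u, v}}

/-! ### Submodels -/

theorem containsSubmodel_iff {A B : Model.{u, v, w} Ω} :
    ContainsSubmodel A B ↔ Nonempty (B ↪[Ω] A) :=
  ⟨fun ⟨S, ⟨e⟩⟩ => ⟨S.subtype.comp e.toEmbedding⟩, fun ⟨j⟩ => ⟨j.toHom.range, ⟨j.equivRange⟩⟩⟩

theorem containsSubmodel_refl (A : Model.{u, v, w} Ω) : ContainsSubmodel A A :=
  containsSubmodel_iff.2 ⟨Embedding.refl Ω A⟩

theorem ContainsSubmodel.trans {A B C : Model.{u, v, w} Ω} (h₁ : ContainsSubmodel A B)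
    (h₂ : ContainsSubmodel B C) : ContainsSubmodel A C := by
  obtain ⟨i⟩ := containsSubmodel_iff.1 h₁
  obtain ⟨j⟩ := containsSubmodel_iff.1 h₂
  exact containsSubmodel_iff.2 ⟨i.comp j⟩

theorem containsSubmodel_of_equiv {A B : Model.{u, v, w} Ω} (e : A ≃[Ω] B) :
    ContainsSubmodel A B :=
  containsSubmodel_iff.2 ⟨e.symm.toEmbedding⟩

/-- The case of `◇` needs no induction hypothesis: isomorphic models contain the same submodels. -/
theorem ModalSentence.sat_iso {K : ModelLanguage.{u, v, w, t} Ω} (φ : ModalSentence K) :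
    ∀ {A B : Model.{u, v, w} Ω}, (A ≃[Ω] B) →
      (φ.Sat Set.univ ContainsSubmodel A ↔ φ.Sat Set.univ ContainsSubmodel B) := by
  induction φ with
  | of ψ => exact fun e => K.sat_iso _ _ ⟨e⟩ ψ
  | bot => exact fun _ => Iff.rfl
  | imp φ ψ ihφ ihψ => exact fun e => imp_congr (ihφ e) (ihψ e)
  | dia φ _ =>
    exact fun e => ⟨
      fun ⟨C, hC, hAC, h⟩ => ⟨C, hC, (containsSubmodel_of_equiv e.symm).trans hAC, h⟩,
      fun ⟨C, hC, hBC, h⟩ => ⟨C, hC, (containsSubmodel_of_equiv e).trans hBC, h⟩⟩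

/-- The least submodel of a model, generated by the constants. -/
def leastSubmodel (hconst : Nonempty Ω.Constants) (A : Model.{u, v, w} Ω) : Model.{u, v, w} Ω :=
  haveI : Nonempty (⊥ : Ω.Substructure A) := by
    obtain ⟨c⟩ := hconst
    exact ⟨⟨_, Substructure.constants_mem c⟩⟩
  ⟨(⊥ : Ω.Substructure A)⟩

theorem containsSubmodel_leastSubmodel (hconst : Nonempty Ω.Constants) {A B : Model.{u, v, w} Ω}
    (h : ContainsSubmodel A B) : ContainsSubmodel B (leastSubmodel hconst A) := by
  obtain ⟨S, ⟨e⟩⟩ := h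
  exact containsSubmodel_iff.2
    ⟨e.symm.toEmbedding.comp (Substructure.inclusion (bot_le : ⊥ ≤ S))⟩

theorem nonempty_equiv_leastSubmodel (hconst : Nonempty Ω.Constants) {A B : Model.{u, v, w} Ω}
    (h : ContainsSubmodel (leastSubmodel hconst A) B) :
    Nonempty (leastSubmodel hconst A ≃[Ω] B) := by
  obtain ⟨j⟩ := containsSubmodel_iff.1 h
  let i : B ↪[Ω] A := (⊥ : Ω.Substructure A).subtype.comp j
  have hle : i.toHom.range ≤ ⊥ := by
    rintro _ ⟨b, rfl⟩
    exact (j b).2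
  have e : B ≃[Ω] i.toHom.range := i.equivRange
  rw [le_bot_iff.1 hle] at e
  exact ⟨e.symm⟩

/-! ### Soundness of `S4.2.1` -/

theorem translate_subst {K : ModelLanguage.{u, v, w, t} Ω} (val : ℕ → ModalSentence K)
    (σ : ℕ → MF) (φ : MF) :
    MF.translate val (MF.subst σ φ) = MF.translate (fun n => MF.translate val (σ n)) φ := by
  induction φ with
  | var n => rfl
  | bot => rfl
  | imp φ ψ ihφ ihψ => simp only [MF.subst, MF.translate, ihφ, ihψ]
  | dia φ ih => simp only [MF.subst, MF.translate, ih]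

theorem isNormalLogic_modalTheory (K : ModelLanguage.{u, v, w, t} Ω)
    (R : Model.{u, v, w} Ω → Model.{u, v, w} Ω → Prop) :
    IsNormalLogic (modalTheory K Set.univ R) where
  tautology φ h := fun val A _ =>
    h (fun ψ => (MF.translate val ψ).Sat Set.univ R A) id fun _ _ => Iff.rfl
  dia_bot := fun _ _ _ ⟨_, _, _, h⟩ => h
  dia_or := by
    rintro val A - ⟨B, hB, hAB, h⟩ hn
    exact ⟨B, hB, hAB, h fun h₀ => hn ⟨B, hB, hAB, h₀⟩⟩
  modus_ponens φ ψ h₁ h₂ := fun val A hA => h₂ val A hA (h₁ val A hA)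
  substitution φ σ h := fun val A hA => by
    rw [translate_subst]
    exact h _ A hA
  monotonicity φ ψ h := fun val A _ ⟨B, hB, hAB, hφ⟩ => ⟨B, hB, hAB, h val B hB hφ⟩

theorem S421_subset_modalTheory (hconst : Nonempty Ω.Constants)
    (K : ModelLanguage.{u, v, w, t} Ω) :
    S421 ⊆ modalTheory K Set.univ ContainsSubmodel := by
  refine leastLogic_subset (isNormalLogic_modalTheory K _) (Set.union_subset
    (leastLogic_subset (isNormalLogic_modalTheory K _) ?_) ?_)
  · rintro _ (rfl | rfl) val A -
    · rintro ⟨B, hB, hAB, C, hC, hBC, h⟩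
      exact ⟨C, hC, hAB.trans hBC, h⟩
    · exact fun h => ⟨A, trivial, containsSubmodel_refl A, h⟩
  · rintro _ rfl val A -
    let M := leastSubmodel hconst A
    have hAM : ContainsSubmodel A M := containsSubmodel_leastSubmodel hconst
      (containsSubmodel_refl A)
    have hM {B} (h : ContainsSubmodel M B) : (val 0).Sat Set.univ ContainsSubmodel M ↔
        (val 0).Sat Set.univ ContainsSubmodel B := by
      obtain ⟨e⟩ := nonempty_equiv_leastSubmodel hconst h
      exact (val 0).sat_iso e
    have h₁ : (MF.translate val (MF.box (MF.dia (MF.var 0)))).Sat Set.univ ContainsSubmodel A ↔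
        (val 0).Sat Set.univ ContainsSubmodel M := by
      refine ⟨fun h => ?_, fun h => ?_⟩
      · by_contra hn
        refine h ⟨M, trivial, hAM, ?_⟩
        rintro ⟨B, -, hMB, hB⟩
        exact hn ((hM hMB).2 hB)
      · rintro ⟨B, -, hAB, hB⟩
        exact hB ⟨M, trivial, containsSubmodel_leastSubmodel hconst hAB, h⟩
    have h₂ : (MF.translate val (MF.dia (MF.box (MF.var 0)))).Sat Set.univ ContainsSubmodel A ↔
        (val 0).Sat Set.univ ContainsSubmodel M := by
      refine ⟨fun ⟨B, _, hAB, hB⟩ => ?_, fun h => ⟨M, trivial, hAM, ?_⟩⟩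
      · by_contra hn
        exact hB ⟨M, trivial, containsSubmodel_leastSubmodel hconst hAB, hn⟩
      · rintro ⟨B, -, hMB, hB⟩
        exact hB ((hM hMB).1 h)
    exact fun h => h (fun h' => h₂.2 (h₁.1 h')) (fun h' => h₁.2 (h₂.1 h'))

/-! ### A model whose submodels form a power set -/

/-- The disjoint union of cycles of length `ℓ i + 2`, for `i : ι`, and of an isolated point. It
carries the structure in which the function symbol `f` rotates its first argument, all other
function symbols are constant, and all relations are empty. -/
def RotationModel {m : ℕ} (_f : Ω.Functions m) (ι : Type) (ℓ : ι → ℕ) : Type w :=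
  ULift.{w} (Option (Σ i : ι, ZMod (ℓ i + 2)))

namespace RotationModel

variable {m : ℕ} {f : Ω.Functions m} {ι : Type} {ℓ : ι → ℕ}

/-- The isolated point. -/
def pt : RotationModel.{u, v, w} f ι ℓ := ⟨none⟩

/-- The points on the cycles. -/
def on (i : ι) (k : ZMod (ℓ i + 2)) : RotationModel.{u, v, w} f ι ℓ := ⟨some ⟨i, k⟩⟩

instance : Nonempty (RotationModel.{u, v, w} f ι ℓ) := ⟨pt⟩

/-- The rotation of all cycles. -/
def rotate : RotationModel.{u, v, w} f ι ℓ → RotationModel.{u, v, w} f ι ℓ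
  | ⟨none⟩ => pt
  | ⟨some ⟨i, k⟩⟩ => on i (k + 1)

theorem pt_or_on (x : RotationModel.{u, v, w} f ι ℓ) : x = pt ∨ ∃ i k, x = on i k := by
  obtain ⟨_ | ⟨i, k⟩⟩ := x
  exacts [Or.inl rfl, Or.inr ⟨i, k, rfl⟩]

theorem on_injective {i j : ι} {k : ZMod (ℓ i + 2)} {l : ZMod (ℓ j + 2)}
    (h : (on i k : RotationModel.{u, v, w} f ι ℓ) = on j l) : (⟨i, k⟩ : Σ i : ι, ZMod (ℓ i + 2)) = ⟨j, l⟩ :=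
  Option.some_injective _ (ULift.up_injective h)

theorem on_ne_pt {i : ι} {k : ZMod (ℓ i + 2)} : (on i k : RotationModel.{u, v, w} f ι ℓ) ≠ pt :=
  fun h => Option.some_ne_none _ (ULift.up_injective h)

theorem rotate_iterate_on (i : ι) (k : ZMod (ℓ i + 2)) (n : ℕ) :
    rotate^[n] (on i k : RotationModel.{u, v, w} f ι ℓ) = on i (k + (n : ZMod (ℓ i + 2))) := by
  induction n with
  | zero => simp
  | succ n ih =>
    rw [Function.iterate_succ_apply', ih, Nat.cast_succ, ← add_assoc]
    rfl

/-- The exact period of a point determines its cycle, as the lengths are distinct. -/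
theorem rotate_iterate_eq_iff (hℓ : Function.Injective ℓ) (x : RotationModel.{u, v, w} f ι ℓ) (i : ι) :
    (∀ n, rotate^[n] x = x ↔ ℓ i + 2 ∣ n) ↔ ∃ k, x = on i k := by
  have key (j) (l : ZMod (ℓ j + 2)) (n : ℕ) :
      rotate^[n] (on j l : RotationModel.{u, v, w} f ι ℓ) = on j l ↔ ℓ j + 2 ∣ n := by
    rw [rotate_iterate_on, ← ZMod.natCast_eq_zero_iff]
    refine ⟨fun h => ?_, fun h => by rw [h, add_zero]⟩
    simpa using on_injective h
  refine ⟨fun h => ?_, fun ⟨k, hk⟩ => by rw [hk]; exact key i k⟩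
  rcases pt_or_on x with rfl | ⟨j, l, rfl⟩
  -- The isolated point has period 1; the summand 2 in the lengths keeps the cycles apart from it.
  · have := (h 1).1 rfl
    have := Nat.le_of_dvd one_pos this
    omega
  · have : ℓ j + 2 = ℓ i + 2 :=
      Nat.dvd_antisymm ((key j l _).1 ((h _).2 dvd_rfl)) ((h _).1 ((key j l _).2 dvd_rfl))
    obtain rfl := hℓ (Nat.add_right_cancel this)
    exact ⟨l, rfl⟩

end RotationModel

/-- The unary operation `x ↦ f(x, …, x)`. -/
def diag {m : ℕ} (f : Ω.Functions m) {M : Type w} [Ω.Structure M] (x : M) : M :=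
  Structure.funMap f fun _ => x

theorem map_diag_iterate {m : ℕ} (f : Ω.Functions m) {M N : Type w} [Ω.Structure M]
    [Ω.Structure N] (j : M ↪[Ω] N) (n : ℕ) (x : M) : j ((diag f)^[n] x) = (diag f)^[n] (j x) := by
  induction n generalizing x with
  | zero => rfl
  | succ n ih =>
    rw [Function.iterate_succ_apply, ih, Function.iterate_succ_apply]
    exact congrArg _ (j.map_fun f _)

theorem diag_mem {m : ℕ} (f : Ω.Functions m) {M : Type w} [Ω.Structure M] (S : Ω.Substructure M)
    {x : M} (hx : x ∈ S) (n : ℕ) : (diag f)^[n] x ∈ S := by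
  induction n with
  | zero => exact hx
  | succ n ih =>
    rw [Function.iterate_succ_apply']
    exact S.fun_mem f _ fun _ => ih

namespace RotationModel

variable {m : ℕ} {f : Ω.Functions m} {ι : Type} {ℓ : ι → ℕ}

open Classical in
noncomputable instance : Ω.Structure (RotationModel.{u, v, w} f ι ℓ) where
  funMap {k} F a :=
    if h : (⟨k, F⟩ : Σ k, Ω.Functions k) = ⟨m, f⟩ ∧ 0 < k then rotate (a ⟨0, h.2⟩) else pt
  RelMap _ _ := False

theorem diag_eq_rotate (hm : 0 < m) :
    (diag f : RotationModel.{u, v, w} f ι ℓ → RotationModel.{u, v, w} f ι ℓ) = rotate :=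
  funext fun _ => dif_pos ⟨rfl, hm⟩

theorem funMap_constants (c : Ω.Constants) (a : Fin 0 → RotationModel.{u, v, w} f ι ℓ) :
    Structure.funMap c a = (pt : RotationModel.{u, v, w} f ι ℓ) :=
  dif_neg fun h => lt_irrefl 0 h.2

/-- The submodel that consists of the isolated point and of the cycles with indices in `Y`. -/
def sub (f : Ω.Functions m) (ℓ : ι → ℕ) (Y : Set ι) :
    Ω.Substructure (RotationModel.{u, v, w} f ι ℓ) where
  carrier := {x | ∀ i k, x = on i k → i ∈ Y}
  fun_mem := by
    classical
    intro k F a ha i l h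
    change dite _ _ _ = _ at h
    split_ifs at h with hF
    · rcases pt_or_on (a ⟨0, hF.2⟩) with h' | ⟨j, l', h'⟩
      · rw [h'] at h
        exact absurd h.symm on_ne_pt
      · rw [h'] at h
        obtain rfl : j = i := congrArg Sigma.fst (on_injective h)
        exact ha _ _ _ h'
    · exact absurd h.symm on_ne_pt

theorem on_mem_sub {Y : Set ι} {i : ι} {k : ZMod (ℓ i + 2)} :
    (on i k : RotationModel.{u, v, w} f ι ℓ) ∈ sub f ℓ Y ↔ i ∈ Y := by
  refine ⟨fun h => h i k rfl, fun h j l hjl => ?_⟩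
  obtain rfl : i = j := congrArg Sigma.fst (on_injective hjl)
  exact h

theorem pt_mem_sub (Y : Set ι) : (pt : RotationModel.{u, v, w} f ι ℓ) ∈ sub f ℓ Y :=
  fun _ _ h => absurd h.symm on_ne_pt

/-- Rotation is transitive on each cycle, so a submodel contains a cycle entirely or misses it; the
isolated point is the value of the constants. -/
theorem exists_eq_sub (hm : 0 < m) (hconst : Nonempty Ω.Constants)
    (S : Ω.Substructure (RotationModel.{u, v, w} f ι ℓ)) : ∃ Y, S = sub f ℓ Y := by
  refine ⟨{i | ∃ k, (on i k : RotationModel.{u, v, w} f ι ℓ) ∈ S}, SetLike.ext fun x => ⟨fun hx i k h => ?_,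
    fun hx => ?_⟩⟩
  · exact ⟨k, h ▸ hx⟩
  · rcases pt_or_on x with rfl | ⟨i, k, rfl⟩
    · obtain ⟨c⟩ := hconst
      have := S.fun_mem c default fun i => i.elim0
      rwa [funMap_constants] at this
    · obtain ⟨l, hl⟩ := on_mem_sub.1 hx
      have := diag_mem f S hl (k - l).val
      rw [diag_eq_rotate hm, rotate_iterate_on, ZMod.natCast_val, ZMod.cast_id] at this
      simpa using this

/-- The model that consists of an isolated point and of the cycles with indices in `Y`. -/
noncomputable def model (f : Ω.Functions m) (ℓ : ι → ℕ) (Y : Set ι) : Model.{u, v, w} Ω :=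
  haveI : Nonempty (sub.{u, v, w} f ℓ Y) := ⟨⟨_, pt_mem_sub Y⟩⟩
  ⟨sub.{u, v, w} f ℓ Y⟩

/-- An embedding commutes with `diag f` and is injective, so it preserves exact periods and sends a
point of a cycle to the cycle with the same index. -/
theorem containsSubmodel_model_iff (hm : 0 < m) (hℓ : Function.Injective ℓ) {Y Z : Set ι} :
    ContainsSubmodel (model.{u, v, w} f ℓ Y) (model f ℓ Z) ↔ Z ⊆ Y := by
  rw [containsSubmodel_iff]
  refine ⟨fun ⟨e⟩ i hi => ?_, fun h => ⟨Substructure.inclusion fun x hx i k hik =>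
    h (hx i k hik)⟩⟩
  let j : sub.{u, v, w} f ℓ Z ↪[Ω] RotationModel.{u, v, w} f ι ℓ := (sub f ℓ Y).subtype.comp e
  let x : sub.{u, v, w} f ℓ Z := ⟨on i 0, on_mem_sub.2 hi⟩
  have hper (n : ℕ) : rotate^[n] (j x : RotationModel.{u, v, w} f ι ℓ) = j x ↔ ℓ i + 2 ∣ n := by
    rw [← (rotate_iterate_eq_iff hℓ (x : RotationModel.{u, v, w} f ι ℓ) i).2 ⟨0, rfl⟩ n,
      ← diag_eq_rotate (f := f) hm, ← map_diag_iterate, j.injective.eq_iff]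
    exact ((sub f ℓ Z).subtype.injective.eq_iff.symm).trans
      (by rw [map_diag_iterate]; rfl)
  obtain ⟨k, hk⟩ := (rotate_iterate_eq_iff hℓ _ i).1 hper
  exact (e x).2 i k hk

theorem containsSubmodel_iff_exists_equiv (hm : 0 < m) (hconst : Nonempty Ω.Constants)
    (hℓ : Function.Injective ℓ) {Y : Set ι} {B : Model.{u, v, w} Ω} :
    ContainsSubmodel (model f ℓ Y) B ↔ ∃ Z ⊆ Y, Nonempty (B ≃[Ω] model.{u, v, w} f ℓ Z) := by
  refine ⟨fun h => ?_, fun ⟨Z, hZ, ⟨e⟩⟩ =>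
    ((containsSubmodel_model_iff hm hℓ).2 hZ).trans (containsSubmodel_of_equiv e.symm)⟩
  obtain ⟨e⟩ := containsSubmodel_iff.1 h
  let j : B ↪[Ω] RotationModel.{u, v, w} f ι ℓ := (sub f ℓ Y).subtype.comp e
  obtain ⟨Z, hZ⟩ := exists_eq_sub hm hconst j.toHom.range
  have e' : B ≃[Ω] j.toHom.range := j.equivRange
  rw [hZ] at e'
  exact ⟨Z, (containsSubmodel_model_iff hm hℓ).1 (h.trans (containsSubmodel_of_equiv e')), ⟨e'⟩⟩

end RotationModel

/-! ### Completeness of `S4.2.1` -/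

theorem exists_countermodel (hfun : ∃ n : ℕ, 1 ≤ n ∧ Nonempty (Ω.Functions n))
    (hconst : Nonempty Ω.Constants) {φ : MF} (hφ : φ ∉ S421) :
    ∃ V : Model.{u, v, w} Ω → ℕ → Prop,
      (∀ A B : Model.{u, v, w} Ω, Nonempty (A ≃[Ω] B) → ∀ n, V A n ↔ V B n) ∧
      ∀ (K : ModelLanguage.{u, v, w, t} Ω) (val : ℕ → ModalSentence K),
        (∀ A n, (val n).Sat Set.univ ContainsSubmodel A ↔ V A n) →
        ∃ A, ¬ (MF.translate val φ).Sat Set.univ ContainsSubmodel A := by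
  obtain ⟨m, hm, ⟨f⟩⟩ := hfun
  obtain ⟨T, hbot, himp, hdia, X₀, hX₀⟩ := exists_powerset_countermodel hφ
  obtain ⟨ℓ, hℓ⟩ := exists_injective_nat (List MF)
  -- Complements appear because `◇` leads to smaller submodels but to larger sets in the power set
  -- frame.
  refine ⟨fun A n => ∃ X, Nonempty (A ≃[Ω] RotationModel.model.{u, v, w} f ℓ Xᶜ) ∧ MF.var n ∈ T X,
    fun A B ⟨e⟩ n => ?_, fun K val hval => ⟨RotationModel.model f ℓ X₀ᶜ, ?_⟩⟩
  · exact ⟨fun ⟨X, ⟨i⟩, h⟩ => ⟨X, ⟨i.comp e.symm⟩, h⟩, fun ⟨X, ⟨i⟩, h⟩ => ⟨X, ⟨i.comp e⟩, h⟩⟩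
  suffices h : ∀ ψ X, (MF.translate val ψ).Sat Set.univ ContainsSubmodel
      (RotationModel.model f ℓ Xᶜ) ↔ ψ ∈ T X by rwa [h]
  intro ψ
  induction ψ with
  | var n =>
    intro X
    refine (hval _ n).trans ⟨?_, fun h => ⟨X, ⟨Language.Equiv.refl Ω _⟩, h⟩⟩
    -- Models for different sets are not isomorphic, so the predicate reads off the right set.
    rintro ⟨Y, ⟨e⟩, h⟩
    have h₁ := (RotationModel.containsSubmodel_model_iff hm hℓ).1 (containsSubmodel_of_equiv e)
    have h₂ := (RotationModel.containsSubmodel_model_iff hm hℓ).1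
      (containsSubmodel_of_equiv e.symm)
    rwa [compl_injective (h₁.antisymm h₂)] at h
  | bot => exact fun X => ⟨False.elim, hbot X⟩
  | imp α β ihα ihβ => exact fun X => (imp_congr (ihα X) (ihβ X)).trans (himp X α β).symm
  | dia α ih =>
    intro X
    rw [hdia]
    constructor
    · rintro ⟨B, -, hB, hα⟩
      obtain ⟨Z, hZ, ⟨e⟩⟩ :=
        (RotationModel.containsSubmodel_iff_exists_equiv hm hconst hℓ).1 hB
      refine ⟨Zᶜ, Set.subset_compl_comm.1 hZ, (ih _).1 ?_⟩
      rw [compl_compl]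
      exact (ModalSentence.sat_iso _ e).1 hα
    · rintro ⟨Y, hXY, hα⟩
      exact ⟨_, trivial, (RotationModel.containsSubmodel_model_iff hm hℓ).2
        (Set.compl_subset_compl.2 hXY), (ih Y).2 hα⟩

/-! ### Expansions of languages by predicates of models -/

/-- The sentences of a language `L` with new atomic sentences indexed by `ι`, closed under
implication. -/
inductive Expansion (S : Type t) (ι : Type) : Type t
  | base : S → Expansion S ι
  | atom : ι → Expansion S ι
  | imp : Expansion S ι → Expansion S ι → Expansion S ι

/-- Satisfaction in an expansion. -/
def Expansion.Sat {S : Type t} {ι : Type} (base : S → Prop) (atom : ι → Prop) :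
    Expansion S ι → Prop
  | .base φ => base φ
  | .atom i => atom i
  | .imp φ ψ => Expansion.Sat base atom φ → Expansion.Sat base atom ψ

/-- The expansion of a language by a family of isomorphism-invariant predicates of models. -/
def ModelLanguage.expand (L : ModelLanguage.{u, v, w, t} Ω) {ι : Type}
    (P : Model.{u, v, w} Ω → ι → Prop)
    (hP : ∀ A B : Model.{u, v, w} Ω, Nonempty (A ≃[Ω] B) → ∀ i, P A i ↔ P B i) :
    ModelLanguage.{u, v, w, t} Ω where
  Sentence := Expansion L.Sentence ι
  Sat A := Expansion.Sat (L.Sat A) (P A)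
  sat_iso A B e φ := by
    induction φ with
    | base φ => exact L.sat_iso A B e φ
    | atom i => exact hP A B e i
    | imp φ ψ ihφ ihψ => exact imp_congr ihφ ihψ
  imp := .imp
  sat_imp _ _ _ := Iff.rfl
  ofFirstOrder φ := .base (L.ofFirstOrder φ)
  ofFirstOrder_injective _ _ h := L.ofFirstOrder_injective (Expansion.base.inj h)
  sat_ofFirstOrder := L.sat_ofFirstOrder

theorem ModelLanguage.includedIn_expand (L : ModelLanguage.{u, v, w, t} Ω) {ι : Type}
    (P : Model.{u, v, w} Ω → ι → Prop)
    (hP : ∀ A B : Model.{u, v, w} Ω, Nonempty (A ≃[Ω] B) → ∀ i, P A i ↔ P B i) :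
    L.IncludedIn (L.expand P hP) :=
  ⟨.base, fun _ _ => Expansion.base.inj, fun _ _ => Iff.rfl⟩

/-- The first-order language. -/
def firstOrderLanguage (Ω : FirstOrder.Language.{u, v}) :
    ModelLanguage.{u, v, w, max u v w} Ω where
  Sentence := ULift.{w} Ω.Sentence
  Sat A φ := Sentence.Realize A φ.down
  sat_iso _ _ := fun ⟨e⟩ φ => StrongHomClass.realize_sentence e φ.down
  imp φ ψ := ⟨φ.down.imp ψ.down⟩
  sat_imp _ _ _ := BoundedFormula.realize_imp
  ofFirstOrder φ := ⟨φ⟩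
  ofFirstOrder_injective _ _ h := ULift.up_injective h
  sat_ofFirstOrder _ _ := Iff.rfl

theorem modalTheory_anti {L K : ModelLanguage.{u, v, w, t} Ω} (h : L.IncludedIn K)
    (C : Set (Model.{u, v, w} Ω)) (R : Model.{u, v, w} Ω → Model.{u, v, w} Ω → Prop) :
    modalTheory K C R ⊆ modalTheory L C R := by
  obtain ⟨i, -, hi⟩ := h
  let tr : ModalSentence L → ModalSentence K := fun φ =>
    φ.rec (fun ψ => .of (i ψ)) .bot (fun _ _ α β => .imp α β) (fun _ α => .dia α)
  have htr (φ : ModalSentence L) : ∀ A, (tr φ).Sat C R A ↔ φ.Sat C R A := by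
    induction φ with
    | of ψ => exact fun A => hi A ψ
    | bot => exact fun _ => Iff.rfl
    | imp φ ψ ihφ ihψ => exact fun A => imp_congr (ihφ A) (ihψ A)
    | dia φ ih => exact fun A => exists_congr fun B => and_congr_right fun _ =>
        and_congr_right fun _ => ih B
  intro φ hφ val A hA
  have htrans : ∀ ψ, tr (MF.translate val ψ) = MF.translate (fun n => tr (val n)) ψ := by
    intro ψ
    induction ψ with
    | var n => rfl
    | bot => rfl
    | imp α β ihα ihβ => exact congrArg₂ ModalSentence.imp ihα ihβ
    | dia α ih => exact congrArg ModalSentence.dia ih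
  rw [← htr, htrans]
  exact hφ _ A hA

/-- Every language has an expansion whose modal theory is `S4.2.1`. -/
theorem exists_includedIn_modalTheory_eq
    (hfun : ∃ n : ℕ, 1 ≤ n ∧ Nonempty (Ω.Functions n)) (hconst : Nonempty Ω.Constants)
    (L : ModelLanguage.{u, v, w, t} Ω) :
    ∃ K : ModelLanguage.{u, v, w, t} Ω, L.IncludedIn K ∧
      modalTheory K Set.univ ContainsSubmodel = S421 := by
  choose V hV hcounter using fun φ : {φ : MF // φ ∉ S421} =>
    exists_countermodel.{u, v, w, t} hfun hconst φ.2
  -- One new atom for each non-theorem and each variable: a single expansion refutes all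
  -- non-theorems.
  let P (A : Model.{u, v, w} Ω) (i : {φ : MF // φ ∉ S421} × ℕ) : Prop := V i.1 A i.2
  have hP (A B : Model.{u, v, w} Ω) (e : Nonempty (A ≃[Ω] B)) (i) : P A i ↔ P B i :=
    hV i.1 A B e i.2
  refine ⟨L.expand P hP, L.includedIn_expand P hP,
    (S421_subset_modalTheory hconst _).antisymm' fun φ hφ => ?_⟩
  by_contra hn
  obtain ⟨A, hA⟩ := hcounter ⟨φ, hn⟩ (L.expand P hP)
    (fun n => .of (.atom (⟨φ, hn⟩, n))) fun _ _ => Iff.rfl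
  exact hA (hφ _ A trivial)

end RobustModal

theorem mainTheorem4 (Ω : FirstOrder.Language.{u, v})
    (hfun : ∃ n : ℕ, 1 ≤ n ∧ Nonempty (Ω.Functions n))
    (hconst : Nonempty Ω.Constants) :
    RobustModal.IsRobustTheory (Set.univ : Set (RobustModal.Model.{u, v, w} Ω))
        RobustModal.ContainsSubmodel RobustModal.S421 ∧
      ∀ Λ : Set RobustModal.MF,
        RobustModal.IsRobustTheory (Set.univ : Set (RobustModal.Model.{u, v, w} Ω))
          RobustModal.ContainsSubmodel Λ → Λ = RobustModal.S421 := by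
  refine ⟨?_, ?_⟩
  · obtain ⟨K, -, hK⟩ := RobustModal.exists_includedIn_modalTheory_eq hfun hconst
      (RobustModal.firstOrderLanguage.{u, v, w} Ω)
    refine ⟨K, fun K' hK' => ?_, hK⟩
    refine (RobustModal.modalTheory_anti hK' _ _).antisymm ?_
    rw [hK]
    exact RobustModal.S421_subset_modalTheory hconst K'
  · rintro Λ ⟨L, hL, rfl⟩
    obtain ⟨K, hLK, hK⟩ := RobustModal.exists_includedIn_modalTheory_eq hfun hconst L
    rw [← hL K hLK, hK]
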